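/- **Setting.** There are $n$ suppliers. With context $\theta_i$, supplier $i$ has the cost function $c_i(\cdot;\phi_i,\theta_i)$ on $[0,\infty)$, where $\phi_i$ is fixed private information. For every context this cost is increasing, continuously differentiable, $\mu_i$-strongly convex ($\mu_i>0$ not depending on the context), and zero at $0$. At price $p$ the supplier produces $x_i^*(p;\theta_i)=\arg\max_{x\ge 0}\{px-c_i(x;\phi_i,\theta_i)\}$, and for $\theta=(\theta_1,\dots,\theta_n)$ the total production is $x^*(p;\theta)=\sum_i x_i^*(p;\theta_i)$. Assume $x^*(p;\theta)\in[0,B]$ for all $p\in[0,1]$ and all $\theta$. A class $\mathcal F$ of real functions of $(p,\theta)$, $p\in[0,1]$, is $\varepsilon$-misspecified for $x^*$ if some $\bar x\in\mathcal F$ satisfies $|\bar x(p;\theta)-x^*(p;\theta)|\le\varepsilon$ for all $(p,\theta)$. An online regression oracle computes from past pairs $(a_1,b_1),\dots,(a_{t-1},b_{t-1})$ a predictor $\hat f_t$ with values in $[0,B]$, where the inputs $a_s$ are pairs $(p,\theta)$. It has error bound $\mathrm{Est}_{\rm sq}(T)$ if, for every sequence $(a_t,b_t)_{t\le T}$ with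 outputs $b_t\in[0,B]$, $$\sum_{t=1}^T(\hat f_t(a_t)-b_t)^2-\inf_{f\in\mathcal F}\sum_{t=1}^T(f(a_t)-b_t)^2\le \mathrm{Est}_{\rm sq}(T).$$ **Algorithm** (inverse gap weighting). Let $K\ge2$, $p_i=\frac{i-1}{K-1}$ for $i=1,\dots,K$, and $\gamma>0$. In each round $t=1,\dots,T$, query the oracle for $\hat f_t$, receive the context $\theta_t$ and the demand $d_t$, and sample the price $p_t$ from $$\Delta_t(p_i)=\frac1{\lambda_t+2\gamma\bigl(|\hat f_t(p_i;\theta_t)-d_t|-\min_j|\hat f_t(p_j;\theta_t)-d_t|\bigr)},$$ where $\lambda_t\in(0,K]$ makes the probabilities sum to $1$. Then observe $x_t=x^*(p_t;\theta_t)$ and pass $((p_t,\theta_t),x_t)$ to the oracle. The context and demand of round $t$ may be chosen adversarially, as functions of the past prices $p_1,\dots,p_{t-1}$ (in particular they may be any fixed sequence), provided that each $d_t$ has an equilibrium price $p_t^*\in[0,1]$, i.e. $x^*(p_t^*;\theta_t)=d_t$. **Theorem.** There is a constant $C>0$ depending only on $n,\mu_1,\dots,\mu_n,B$ such that the following holds.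 Suppose that $\mathcal F$ is $\varepsilon$-misspecified for $x^*$ and that the oracle has error bound $\mathrm{Est}_{\rm sq}(T)$. Let $0<\delta<1$, and run the algorithm with $$\gamma=\sqrt{\frac{KT}{\mathrm{Est}_{\rm sq}(T)+\varepsilon^2T+\log(1/\delta)}}.$$ Then for any such choice of contexts and demands, with probability at least $1-\delta$, $$\sum_{t=1}^T\mathbb E_{p_t\sim\Delta_t}\bigl[|x^*(p_t;\theta_t)-d_t|\,\big|\,\mathcal H_{t-1}\bigr]\le C\Bigl(\sqrt{KT\,\mathrm{Est}_{\rm sq}(T)}+\varepsilon\sqrt K\,T+\frac TK+\sqrt{KT\log(1/\delta)}\Bigr),$$ where $\mathcal H_{t-1}$ is the history of the first $t-1$ rounds. -/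

import Mathlib

open Set Finset
open scoped NNReal ENNReal

universe u v

noncomputable section

namespace EqPricing

/-- A supplier's cost function on `[0, ∞)`: increasing, continuously differentiable,
`μ`-strongly convex and normalized by `c 0 = 0`. Values at negative arguments play no role. -/
structure IsSupplierCost (μ : ℝ) (c : ℝ → ℝ) : Prop where
  monotone : MonotoneOn c (Ici 0)
  contDiff : ContDiffOn ℝ 1 c (Ici 0)
  strongConvex : StrongConvexOn (Ici 0) μ c
  zero : c 0 = 0

/-- The production of a supplier with cost `c` at the posted price `p`:
a maximizer of the profit `p x - c x` over `x ≥ 0` (unique when `c` is strongly convex). -/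
def supplierProduction (c : ℝ → ℝ) (p : ℝ) : ℝ :=
  Classical.epsilon fun x : ℝ => 0 ≤ x ∧ IsMaxOn (fun y : ℝ => p * y - c y) (Ici 0) x

/-- A market with `n` suppliers. Supplier `i` has the cost `cost i (φ i) θᵢ`, where `φ i` is its
time-invariant private information and `θᵢ` is the time-varying context. -/
structure Market (n : ℕ) where
  Φ : Fin n → Type u
  Θ : Fin n → Type v
  cost : (i : Fin n) → Φ i → Θ i → ℝ → ℝ
  φ : (i : Fin n) → Φ i

namespace Market

variable {n : ℕ} (M : Market.{u, v} n)

/-- A context `θ = (θ₁, …, θₙ)` for the whole market. -/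
abbrev Context : Type v := (i : Fin n) → M.Θ i

/-- Inputs of the production map: a price in `[0, 1]` and a context. -/
abbrev Input : Type v := Icc (0 : ℝ) 1 × M.Context

/-- The total optimal production `x*(p; θ)` of the suppliers. -/
def production (a : M.Input) : ℝ :=
  ∑ i, supplierProduction (M.cost i (M.φ i) (a.2 i)) a.1

end Market

/-- The class `G` is `ε`-misspecified with respect to the ground truth `g`. -/
def IsMisspecified {A : Type*} (G : Set (A → ℝ)) (g : A → ℝ) (ε : ℝ) : Prop :=
  ∃ gbar ∈ G, ∀ a, |gbar a - g a| ≤ ε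

/-- An online regression rule: from the past pairs `(a₁, b₁), …, (aₜ₋₁, bₜ₋₁)`, listed with the
most recent pair first, it computes the predictor for round `t`. -/
abbrev Oracle (A : Type*) : Type _ := List (A × ℝ) → A → ℝ

namespace Oracle

variable {A : Type*}

/-- The cumulative square loss `∑ₜ (f̂ₜ(aₜ) - bₜ)²` of the rule on a data sequence
(most recent pair first). -/
def sqLoss (O : Oracle A) : List (A × ℝ) → ℝ
  | [] => 0
  | z :: data => sqLoss O data + (O data z.1 - z.2) ^ 2

/-- On every data sequence of length `T` with outputs in `S`, the cumulative square loss of the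
rule exceeds that of the best function in the class `F` by at most `E`. -/
def HasEstError (O : Oracle A) (F : Set (A → ℝ)) (S : Set ℝ) (T : ℕ) (E : ℝ) : Prop :=
  ∀ data : List (A × ℝ), data.length = T → (∀ z ∈ data, z.2 ∈ S) →
    O.sqLoss data - (⨅ f : F, (data.map fun z => (f.1 z.1 - z.2) ^ 2).sum) ≤ E

end Oracle

section IGW

variable {K : ℕ} [NeZero K]

/-- The gap `v i - minⱼ v j`. -/
def gap (v : Fin K → ℝ) (i : Fin K) : ℝ := v i - ⨅ j, v j

theorem gap_nonneg (v : Fin K → ℝ) (i : Fin K) : 0 ≤ gap v i :=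
  sub_nonneg.2 (ciInf_le (Set.finite_range v).bddBelow i)

/-- The normalization constant of inverse gap weighting exists. -/
theorem exists_normalizer (γ : ℝ≥0) (v : Fin K → ℝ) :
    ∃ l : ℝ, (0 < l ∧ l ≤ K) ∧ ∑ i, 1 / (l + 2 * γ * gap v i) = 1 := by
  have hK : (1 : ℝ) ≤ K := by exact_mod_cast NeZero.one_le
  have hg : ∀ i, 0 ≤ 2 * (γ : ℝ) * gap v i := fun i =>
    mul_nonneg (by positivity) (gap_nonneg v i)
  have hc : ContinuousOn (fun l : ℝ => ∑ i, 1 / (l + 2 * γ * gap v i)) (Icc 1 (K : ℝ)) := by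
    refine continuousOn_finsetSum _ fun i _ => ?_
    refine continuousOn_const.div (by fun_prop) fun l hl => ?_
    have := hg i
    have := hl.1
    positivity
  have h1 : (1 : ℝ) ≤ ∑ i, 1 / (1 + 2 * γ * gap v i) := by
    obtain ⟨j, hj⟩ := exists_eq_ciInf_of_finite (f := v)
    have h0 : gap v j = 0 := by simp [gap, hj]
    calc (1 : ℝ) = 1 / (1 + 2 * γ * gap v j) := by simp [h0]
      _ ≤ _ := Finset.single_le_sum (f := fun i => 1 / (1 + 2 * (γ : ℝ) * gap v i))
        (fun i _ => by have := hg i; positivity) (Finset.mem_univ j)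
  have h2 : ∑ i, 1 / ((K : ℝ) + 2 * γ * gap v i) ≤ 1 := by
    calc ∑ i, 1 / ((K : ℝ) + 2 * γ * gap v i) ≤ ∑ _i : Fin K, 1 / (K : ℝ) :=
          Finset.sum_le_sum fun i _ =>
            one_div_le_one_div_of_le (by linarith) (by linarith [hg i])
      _ = 1 := by
        have : (K : ℝ) ≠ 0 := by linarith
        simp [this]
  obtain ⟨l, hl, hl'⟩ := intermediate_value_Icc' hK hc ⟨h2, h1⟩
  exact ⟨l, ⟨by linarith [hl.1], hl.2⟩, hl'⟩

/-- The normalization constant `λ ∈ (0, K]` of inverse gap weighting. -/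
def normalizer (γ : ℝ≥0) (v : Fin K → ℝ) : ℝ := (exists_normalizer γ v).choose

/-- The inverse-gap-weighting distribution: index `i` has the probability
`1 / (λ + 2 γ (v i - minⱼ v j))`. -/
def igw (γ : ℝ≥0) (v : Fin K → ℝ) : PMF (Fin K) :=
  PMF.ofFintype (fun i => ENNReal.ofReal (1 / (normalizer γ v + 2 * γ * gap v i))) (by
    have h := (exists_normalizer γ v).choose_spec
    rw [← ENNReal.ofReal_sum_of_nonneg]
    · exact (congrArg ENNReal.ofReal h.2).trans ENNReal.ofReal_one
    · intro i _
      have h0 : 0 < normalizer γ v := h.1.1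
      have := gap_nonneg v i
      positivity)

/-- The `K` uniformly spaced prices `0, 1/(K-1), …, 1`. -/
def gridPrice (i : Fin K) : Icc (0 : ℝ) 1 :=
  ⟨(i : ℝ) / ((K : ℝ) - 1), by
    have h : (i : ℝ) + 1 ≤ K := by exact_mod_cast i.2
    have h0 : (0 : ℝ) ≤ i := Nat.cast_nonneg _
    exact ⟨div_nonneg h0 (by linarith), div_le_one_of_le₀ (by linarith) (by linarith)⟩⟩

/-- An environment choosing contexts and demands, possibly adversarially. The context and the
demand of a round may depend on the prices posted before (indices in the grid, most recent
first); a fixed sequence is the case where they depend only on the number of past rounds. -/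
structure Environment (Ctx : Type*) (K : ℕ) where
  context : List (Fin K) → Ctx
  demand : List (Fin K) → ℝ

variable {n : ℕ} (M : Market.{u, v} n) (O : Oracle M.Input) (γ : ℝ≥0)
  (env : Environment M.Context K)

/-- The data `((pₛ, θₛ), x*(pₛ; θₛ))` passed to the oracle in the past rounds. -/
def observations : List (Fin K) → List (M.Input × ℝ)
  | [] => []
  | i :: h =>
    ((gridPrice i, env.context h), M.production (gridPrice i, env.context h)) :: observations h

/-- The distribution `Δₜ` of the price posted by the algorithm after the price history `h`. -/
def priceDist (h : List (Fin K)) : PMF (Fin K) :=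
  igw γ fun i => |O (observations M env h) (gridPrice i, env.context h) - env.demand h|

/-- The law of the prices posted by the algorithm in `T` rounds (most recent first). -/
def run : ℕ → PMF (List (Fin K))
  | 0 => PMF.pure []
  | T + 1 => (run T).bind fun h => (priceDist M O γ env h).map fun i => i :: h

/-- The proxy regret `∑ₜ E_{pₜ ∼ Δₜ} [|x*(pₜ; θₜ) - dₜ| | Hₜ₋₁]` along a realized price history. -/
def proxyRegret : List (Fin K) → ℝ
  | [] => 0
  | _ :: h => proxyRegret h + ∑ i, (priceDist M O γ env h i).toReal *
      |M.production (gridPrice i, env.context h) - env.demand h|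

end IGW

end EqPricing

end

/-! Strong convexity makes production Lipschitz in the price, with constant `L = ∑ i, 2 / μ i`, so
some grid price clears the demand up to `2 * L / K`. Let `v` be the predicted and `w` the true
imbalances on the grid. Inverse gap weighting bounds the mean of `w` by `w j` for any `j`, plus `γ`
times the mean of `(v - w) ^ 2`, plus `2 * K / γ` (`sum_igw_mul_le`), and `|v - w|` is at most the
prediction error. It remains to bound the conditional mean squared errors. An exponential
supermartingale compares them with the realized loss (`cumMeanSqError_le_with_high_probability`),
which is at most `Est + ε ^ 2 * T` because outputs are noiseless. The chosen `γ` balances `K * T /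
γ` against `γ` times the total error. -/

namespace EqPricing

/-! ### Optimal production -/

section Supplier

variable {μ : ℝ} {c : ℝ → ℝ}

theorem IsSupplierCost.midpoint_le (hc : IsSupplierCost μ c) {x y : ℝ} (hx : 0 ≤ x) (hy : 0 ≤ y) :
    c ((x + y) / 2) ≤ (c x + c y) / 2 - μ / 8 * (x - y) ^ 2 := by
  have h := hc.strongConvex.2 (Set.mem_Ici.2 hx) (Set.mem_Ici.2 hy)
    (show (0 : ℝ) ≤ 1 / 2 by norm_num) (show (0 : ℝ) ≤ 1 / 2 by norm_num) (by norm_num)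
  simp only [smul_eq_mul, Real.norm_eq_abs, sq_abs] at h
  have e : (x + y) / 2 = 1 / 2 * x + 1 / 2 * y := by ring
  rw [e]
  linarith

/-- The midpoint inequality against `0` gives `c y ≥ μ / 4 * y ^ 2`, so the profit is nonpositive
beyond `4 * |p| / μ` and a maximum over a compact interval suffices. -/
theorem IsSupplierCost.exists_isMaxOn (hc : IsSupplierCost μ c) (hμ : 0 < μ) (p : ℝ) :
    ∃ x : ℝ, 0 ≤ x ∧ IsMaxOn (fun y : ℝ => p * y - c y) (Ici 0) x := by
  have hcont : ContinuousOn (fun y : ℝ => p * y - c y) (Icc 0 (4 * |p| / μ)) :=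
    ((continuous_const.mul continuous_id).continuousOn).sub
      (hc.contDiff.continuousOn.mono Icc_subset_Ici_self)
  have hR : 0 ≤ 4 * |p| / μ := by positivity
  obtain ⟨x, hx, hmax⟩ := isCompact_Icc.exists_isMaxOn ⟨0, le_rfl, hR⟩ hcont
  refine ⟨x, hx.1, fun y hy => ?_⟩
  rw [Set.mem_Ici] at hy
  rcases le_or_gt y (4 * |p| / μ) with h | h
  · exact hmax ⟨hy, h⟩
  have h0 : p * 0 - c 0 ≤ p * x - c x := hmax (⟨le_rfl, hR⟩ : (0 : ℝ) ∈ Icc 0 (4 * |p| / μ))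
  have hmid := hc.midpoint_le hy le_rfl
  have hpos : c 0 ≤ c ((y + 0) / 2) :=
    hc.monotone (Set.mem_Ici.2 le_rfl) (Set.mem_Ici.2 (by linarith)) (by linarith)
  rw [hc.zero] at h0 hmid hpos
  have hgrow : μ / 4 * y ^ 2 ≤ c y := by linarith
  rw [div_lt_iff₀ hμ] at h
  have hrev : p * y ≤ |p| * y := mul_le_mul_of_nonneg_right (le_abs_self p) hy
  have hprod := mul_le_mul_of_nonneg_right h.le hy
  change p * y - c y ≤ p * x - c x
  linarith

theorem supplierProduction_spec (hc : IsSupplierCost μ c) (hμ : 0 < μ) (p : ℝ) :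
    0 ≤ supplierProduction c p ∧
      IsMaxOn (fun y : ℝ => p * y - c y) (Ici 0) (supplierProduction c p) :=
  Classical.epsilon_spec (hc.exists_isMaxOn hμ p)

/-- Each optimum is tested against the midpoint of the two. Adding the two inequalities leaves
strong convexity against `(p - q) * (x - y)`; no derivative is needed. -/
theorem supplierProduction_lipschitz (hc : IsSupplierCost μ c) (hμ : 0 < μ) (p q : ℝ) :
    |supplierProduction c p - supplierProduction c q| ≤ 2 / μ * |p - q| := by
  obtain ⟨hx, hxm⟩ := supplierProduction_spec hc hμ p
  obtain ⟨hy, hym⟩ := supplierProduction_spec hc hμ q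
  set x := supplierProduction c p
  set y := supplierProduction c q
  have hm : (x + y) / 2 ∈ Ici (0 : ℝ) := Set.mem_Ici.2 (by linarith)
  have h1 : p * ((x + y) / 2) - c ((x + y) / 2) ≤ p * x - c x := hxm hm
  have h2 : q * ((x + y) / 2) - c ((x + y) / 2) ≤ q * y - c y := hym hm
  have h3 := hc.midpoint_le hx hy
  have h4 : μ / 2 * |x - y| ^ 2 ≤ |p - q| * |x - y| := by
    rw [sq_abs, ← abs_mul]
    refine le_trans ?_ (le_abs_self _)
    linarith
  rw [div_mul_eq_mul_div, le_div_iff₀ hμ]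
  rcases (abs_nonneg (x - y)).eq_or_lt with h | h
  · rw [← h]
    have := abs_nonneg (p - q)
    linarith
  · have : μ / 2 * |x - y| ≤ |p - q| := le_of_mul_le_mul_right (by linarith) h
    linarith

theorem Market.production_lipschitz {n : ℕ} {μ : Fin n → ℝ} (hμ : ∀ i, 0 < μ i)
    (M : Market.{u, v} n) (hM : ∀ i θ, IsSupplierCost (μ i) (M.cost i (M.φ i) θ))
    (p q : Icc (0 : ℝ) 1) (θ : M.Context) :
    |M.production (p, θ) - M.production (q, θ)| ≤ (∑ i, 2 / μ i) * |(p : ℝ) - q| := by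
  unfold Market.production
  rw [← Finset.sum_sub_distrib, Finset.sum_mul]
  exact (Finset.abs_sum_le_sum_abs _ _).trans
    (Finset.sum_le_sum fun i _ => supplierProduction_lipschitz (hM i _) (hμ i) _ _)

end Supplier

/-! ### Inverse gap weighting -/

section IGW

variable {K : ℕ}

theorem exists_gridPrice_near (hK : 2 ≤ K) (p : Icc (0 : ℝ) 1) :
    ∃ i : Fin K, |(gridPrice i : ℝ) - p| ≤ 2 / K := by
  obtain ⟨p, hp0, hp1⟩ := p
  have hK' : (2 : ℝ) ≤ K := by exact_mod_cast hK
  have hnn : 0 ≤ p * ((K : ℝ) - 1) := mul_nonneg hp0 (by linarith)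
  have hfl := Nat.floor_le hnn
  have hfl' := Nat.lt_floor_add_one (p * ((K : ℝ) - 1))
  have hlt : ⌊p * ((K : ℝ) - 1)⌋₊ < K := by
    have : (⌊p * ((K : ℝ) - 1)⌋₊ : ℝ) < K := by nlinarith
    exact_mod_cast this
  refine ⟨⟨_, hlt⟩, ?_⟩
  have hpos : (0 : ℝ) < (K : ℝ) - 1 := by linarith
  change |(⌊p * ((K : ℝ) - 1)⌋₊ : ℝ) / ((K : ℝ) - 1) - p| ≤ 2 / K
  have h1 : |(⌊p * ((K : ℝ) - 1)⌋₊ : ℝ) / ((K : ℝ) - 1) - p| ≤ 1 / ((K : ℝ) - 1) := by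
    rw [div_sub' hpos.ne', abs_div, abs_of_pos hpos]
    gcongr
    rw [abs_le]
    constructor <;> linarith
  refine h1.trans ?_
  rw [div_le_div_iff₀ hpos (by linarith)]
  linarith

variable [NeZero K]

theorem normalizer_pos (γ : ℝ≥0) (v : Fin K → ℝ) : 0 < normalizer γ v :=
  (exists_normalizer γ v).choose_spec.1.1

theorem normalizer_le (γ : ℝ≥0) (v : Fin K → ℝ) : normalizer γ v ≤ K :=
  (exists_normalizer γ v).choose_spec.1.2

theorem igw_toReal (γ : ℝ≥0) (v : Fin K → ℝ) (i : Fin K) :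
    (igw γ v i).toReal = 1 / (normalizer γ v + 2 * γ * gap v i) := by
  have h0 := normalizer_pos γ v
  have := gap_nonneg v i
  simp only [igw, PMF.ofFintype_apply]
  exact ENNReal.toReal_ofReal (by positivity)

theorem sum_toReal_eq_one {α : Type*} [Fintype α] (q : PMF α) : ∑ i, (q i).toReal = 1 := by
  rw [← ENNReal.toReal_sum fun i _ => q.apply_ne_top i, ← tsum_fintype (L := .unconditional _),
    q.tsum_coe, ENNReal.toReal_one]

/-- The decision-estimation inequality for inverse gap weighting. -/
theorem sum_igw_mul_le (γ : ℝ≥0) (hγ : 0 < γ) (v w : Fin K → ℝ) (j : Fin K) :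
    ∑ i, (igw γ v i).toReal * w i ≤
      w j + γ * ∑ i, (igw γ v i).toReal * (v i - w i) ^ 2 + 2 * K / γ := by
  have hγ' : (0 : ℝ) < γ := hγ
  have hK : (1 : ℝ) ≤ K := by exact_mod_cast (NeZero.one_le : 1 ≤ K)
  set q : Fin K → ℝ := fun i => (igw γ v i).toReal with hq
  have hq1 : ∑ i, q i = 1 := sum_toReal_eq_one _
  have hq0 : ∀ i, 0 ≤ q i := fun i => ENNReal.toReal_nonneg
  have hqe : ∀ i, q i * (normalizer γ v + 2 * γ * gap v i) = 1 := fun i => by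
    have := normalizer_pos γ v
    have := gap_nonneg v i
    simp only [hq, igw_toReal]
    exact one_div_mul_cancel (by positivity)
  have hterm : ∀ i, q i * w i ≤ q i * (⨅ k, v k) + 1 / (2 * γ) +
      (γ / 2 * (q i * (v i - w i) ^ 2) + q i * (1 / (2 * γ))) := fun i => by
    -- Since `q i * (λ + 2 * γ * gap v i) = 1`, every index has the same bounded share of the
    -- expected gap.
    have h1 : q i * gap v i ≤ 1 / (2 * γ) := by
      rw [le_div_iff₀ (by positivity)]
      have := mul_nonneg (hq0 i) (normalizer_pos γ v).le
      linarith [hqe i]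
    have h2 : w i - v i ≤ γ / 2 * (v i - w i) ^ 2 + 1 / (2 * γ) := by
      have : γ / 2 * (v i - w i) ^ 2 + 1 / (2 * γ) - (w i - v i) =
          (γ * (v i - w i) + 1) ^ 2 / (2 * γ) := by
        field_simp
        ring
      have : 0 ≤ (γ * (v i - w i) + 1) ^ 2 / (2 * (γ : ℝ)) := by positivity
      linarith
    have h3 := mul_le_mul_of_nonneg_left h2 (hq0 i)
    unfold gap at h1
    linarith
  have hsum := Finset.sum_le_sum fun i (_ : i ∈ Finset.univ) => hterm i
  simp only [Finset.sum_add_distrib, ← Finset.sum_mul, ← Finset.mul_sum, hq1, Finset.sum_const,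
    Finset.card_univ, Fintype.card_fin, nsmul_eq_mul] at hsum
  -- AM-GM weighted by `q j` costs `1 / (2 * γ * q j)`, which is `λ / (2 * γ) + gap v j`. This `gap
  -- v j` turns `v j` into the minimum of `v`, so an unlikely comparator costs nothing extra.
  have hj : v j - w j ≤ γ / 2 * (q j * (v j - w j) ^ 2) + K / (2 * γ) + gap v j := by
    have hl := normalizer_le γ v
    have hpos : 0 < normalizer γ v + 2 * γ * gap v j := by
      have := normalizer_pos γ v
      have := gap_nonneg v j
      positivity
    have hqj : 0 < q j := by
      rcases (hq0 j).eq_or_lt with h | h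
      · have := hqe j
        rw [← h] at this
        norm_num at this
      · exact h
    have e : (γ / 2 * (q j * (v j - w j) ^ 2) +
        (normalizer γ v + 2 * γ * gap v j) / (2 * γ)) - (v j - w j) =
        q j / (2 * γ) * (γ * (v j - w j) - (normalizer γ v + 2 * γ * gap v j)) ^ 2 := by
      have h := hqe j
      set l := normalizer γ v + 2 * γ * gap v j
      have hl : l = 1 / q j := by
        rw [eq_div_iff hqj.ne']
        linarith
      rw [hl]
      field_simp
      ring
    have h0 : 0 ≤ q j / (2 * γ) *
        (γ * (v j - w j) - (normalizer γ v + 2 * γ * gap v j)) ^ 2 := by positivity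
    have h1 : (normalizer γ v + 2 * γ * gap v j) / (2 * γ) ≤ K / (2 * γ) + gap v j := by
      rw [div_add' _ _ _ (by positivity)]
      refine div_le_div_of_nonneg_right ?_ (by positivity)
      linarith
    linarith
  have hj' : q j * (v j - w j) ^ 2 ≤ ∑ i, q i * (v i - w i) ^ 2 :=
    Finset.single_le_sum (f := fun i => q i * (v i - w i) ^ 2)
      (fun i _ => mul_nonneg (hq0 i) (sq_nonneg _)) (Finset.mem_univ j)
  have hj'' := mul_le_mul_of_nonneg_left hj' (by positivity : 0 ≤ (γ : ℝ) / 2)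
  have hfin : K * (1 / (2 * (γ : ℝ))) + K / (2 * γ) + 1 / (2 * γ) ≤ 2 * K / γ := by
    rw [show K * (1 / (2 * (γ : ℝ))) + K / (2 * γ) + 1 / (2 * γ) = (K + 1 / 2) / γ by
      field_simp; ring]
    gcongr
    linarith
  unfold gap at hj
  linarith

end IGW

/-! ### Concentration of the square loss -/

section Concentration

theorem tsum_pure_mul {α : Type*} (a : α) (f : α → ℝ≥0∞) : ∑' x, PMF.pure a x * f x = f a := by
  rw [tsum_eq_single a fun x hx => by simp [PMF.pure_apply, hx]]
  simp

theorem tsum_bind_mul {α β : Type*} (p : PMF α) (g : α → PMF β) (f : β → ℝ≥0∞) :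
    ∑' y, p.bind g y * f y = ∑' x, p x * ∑' y, g x y * f y := by
  simp only [PMF.bind_apply, ← ENNReal.tsum_mul_right, ← ENNReal.tsum_mul_left]
  rw [ENNReal.tsum_comm]
  simp only [mul_assoc]

theorem tsum_map_mul {α β : Type*} (p : PMF α) (g : α → β) (f : β → ℝ≥0∞) :
    ∑' y, p.map g y * f y = ∑' x, p x * f (g x) := by
  simp only [PMF.map, tsum_bind_mul, Function.comp_apply, tsum_pure_mul]

theorem exp_neg_le_one_sub_half {x : ℝ} (h0 : 0 ≤ x) (h1 : x ≤ 1) : Real.exp (-x) ≤ 1 - x / 2 := by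
  rw [Real.exp_neg, inv_le_comm₀ (Real.exp_pos _) (by linarith)]
  have h3 := Real.quadratic_le_exp_of_nonneg h0
  refine le_trans ?_ h3
  rw [inv_le_iff_one_le_mul₀ (by linarith)]
  nlinarith [mul_nonneg h0 (sub_nonneg.2 h1), mul_nonneg h0 h0,
    mul_nonneg (mul_nonneg h0 h0) (sub_nonneg.2 h1)]

/-- On `[0, 1]`, `exp (-z) ≤ 1 - z / 2`, so the mean of `exp (-z)` is at most `1 - m / 2 ≤ exp (-m /
2)`. Giving up half the mean avoids any variance term. -/
theorem sum_mul_exp_le_one {α : Type*} [Fintype α] (q : PMF α) {z : α → ℝ}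
    (h0 : ∀ i, 0 ≤ z i) (h1 : ∀ i, z i ≤ 1) :
    ∑ i, (q i).toReal * Real.exp ((∑ j, (q j).toReal * z j) / 2 - z i) ≤ 1 := by
  set m := ∑ j, (q j).toReal * z j with hm
  calc ∑ i, (q i).toReal * Real.exp (m / 2 - z i)
      ≤ ∑ i, (q i).toReal * (Real.exp (m / 2) * (1 - z i / 2)) := by
        gcongr with i
        rw [sub_eq_add_neg, Real.exp_add]
        gcongr
        exact exp_neg_le_one_sub_half (h0 i) (h1 i)
    _ = Real.exp (m / 2) * (∑ i, (q i).toReal - m / 2) := by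
        rw [hm, Finset.sum_div, ← Finset.sum_sub_distrib, Finset.mul_sum]
        exact Finset.sum_congr rfl fun i _ => by ring
    _ ≤ Real.exp (m / 2) * Real.exp (-(m / 2)) := by
        rw [sum_toReal_eq_one]
        gcongr
        linarith [Real.add_one_le_exp (-(m / 2))]
    _ = 1 := by rw [← Real.exp_add, add_neg_cancel, Real.exp_zero]

variable {K : ℕ} [NeZero K] {n : ℕ} (M : Market.{u, v} n) (O : Oracle M.Input) (γ : ℝ≥0)
  (env : Environment M.Context K)

/-- The squared prediction error at grid price `i` after the price history `h`. -/
noncomputable def sqError (h : List (Fin K)) (i : Fin K) : ℝ :=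
  (O (observations M env h) (gridPrice i, env.context h) -
    M.production (gridPrice i, env.context h)) ^ 2

/-- The conditional mean of the squared prediction error after the price history `h`. -/
noncomputable def meanSqError (h : List (Fin K)) : ℝ :=
  ∑ i, (priceDist M O γ env h i).toReal * sqError M O env h i

/-- The sum of the conditional mean squared prediction errors along a price history. -/
noncomputable def cumMeanSqError : List (Fin K) → ℝ
  | [] => 0
  | _ :: h => cumMeanSqError h + meanSqError M O γ env h

/-- The exponential supermartingale controlling the squared prediction errors. -/
noncomputable def expWeight (R : ℝ) (h : List (Fin K)) : ℝ≥0∞ :=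
  ENNReal.ofReal (Real.exp ((cumMeanSqError M O γ env h / 2 -
    O.sqLoss (observations M env h)) / R))

theorem tsum_run_mul_expWeight_le_one {R : ℝ} (hR : 0 < R)
    (hZ : ∀ h i, sqError M O env h i ≤ R) (T : ℕ) :
    ∑' h, run M O γ env T h * expWeight M O γ env R h ≤ 1 := by
  induction T with
  | zero => simp [run, expWeight, cumMeanSqError, observations, Oracle.sqLoss]
  | succ T ih =>
    rw [run, tsum_bind_mul]
    refine le_trans (ENNReal.tsum_le_tsum fun h => ?_) ih
    gcongr
    rw [tsum_map_mul, tsum_fintype]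
    have hstep : ∀ i, priceDist M O γ env h i * expWeight M O γ env R (i :: h) =
        expWeight M O γ env R h * ENNReal.ofReal ((priceDist M O γ env h i).toReal *
          Real.exp ((∑ j, (priceDist M O γ env h j).toReal * (sqError M O env h j / R)) / 2 -
            sqError M O env h i / R)) := fun i => by
      rw [ENNReal.ofReal_mul ENNReal.toReal_nonneg, ENNReal.ofReal_toReal (PMF.apply_ne_top _ i),
        mul_left_comm, expWeight, expWeight, ← ENNReal.ofReal_mul (Real.exp_pos _).le,
        ← Real.exp_add]
      congr 3
      have e : ∑ j, (priceDist M O γ env h j).toReal * (sqError M O env h j / R) =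
          meanSqError M O γ env h / R := by
        rw [meanSqError, Finset.sum_div]
        exact Finset.sum_congr rfl fun j _ => by ring
      have e' : O.sqLoss (observations M env (i :: h)) =
          O.sqLoss (observations M env h) + sqError M O env h i := rfl
      rw [e, e', cumMeanSqError]
      ring
    simp only [hstep]
    rw [← Finset.mul_sum, ← ENNReal.ofReal_sum_of_nonneg fun i _ => by positivity]
    refine mul_le_of_le_one_right' (ENNReal.ofReal_le_one.2 (sum_mul_exp_le_one _ ?_ ?_))
    · exact fun i => div_nonneg (sq_nonneg _) hR.le
    · exact fun i => div_le_one_of_le₀ (hZ h i) hR.le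

/-- The oracle's guarantee covers only data of length `T`, so the good event must record the length.
-/
theorem length_of_run_ne_zero {T : ℕ} {h : List (Fin K)} (hh : run M O γ env T h ≠ 0) :
    h.length = T := by
  induction T generalizing h with
  | zero =>
    have : h ∈ (PMF.pure ([] : List (Fin K))).support := hh
    simp_all
  | succ T ih =>
    have hs : h ∈ ((run M O γ env T).bind fun h =>
      (priceDist M O γ env h).map fun i => i :: h).support := hh
    simp only [PMF.mem_support_bind_iff, PMF.mem_support_map_iff] at hs
    obtain ⟨h', hh', i, -, rfl⟩ := hs
    simp [ih hh']

/-- Markov's inequality: outside `s` the weight `W`, of mean at most `1`, is at least `1 / δ`. -/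
theorem one_sub_le_toOuterMeasure {α : Type*} (p : PMF α) (W : α → ℝ≥0∞)
    (hW : ∑' x, p x * W x ≤ 1) {δ : ℝ} (hδ : 0 ≤ δ) (s : Set α)
    (hs : ∀ x, p x ≠ 0 → x ∉ s → 1 ≤ ENNReal.ofReal δ * W x) :
    ENNReal.ofReal (1 - δ) ≤ p.toOuterMeasure s := by
  rw [ENNReal.ofReal_sub _ hδ, ENNReal.ofReal_one, tsub_le_iff_right, ← p.tsum_coe,
    p.toOuterMeasure_apply]
  calc ∑' x, p x ≤ ∑' x, (s.indicator p x + ENNReal.ofReal δ * (p x * W x)) := by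
        refine ENNReal.tsum_le_tsum fun x => ?_
        by_cases hx : x ∈ s
        · simp [hx]
        by_cases hp : p x = 0
        · simp [hp]
        · rw [mul_left_comm]
          exact (le_mul_of_one_le_right' (hs x hp hx)).trans le_add_self
    _ ≤ _ := by
        rw [ENNReal.tsum_add, ENNReal.tsum_mul_left]
        gcongr
        exact mul_le_of_le_one_right' hW

/-- With probability at least `1 - δ`, the cumulative conditional mean of the squared prediction
errors is at most twice the realized square loss, up to a logarithmic term. -/
theorem cumMeanSqError_le_with_high_probability {R : ℝ} (hR : 0 < R)
    (hZ : ∀ h i, sqError M O env h i ≤ R) (T : ℕ) {δ : ℝ} (hδ : 0 < δ) :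
    ENNReal.ofReal (1 - δ) ≤ (run M O γ env T).toOuterMeasure
      {h | h.length = T ∧ cumMeanSqError M O γ env h ≤
        2 * O.sqLoss (observations M env h) + 2 * R * Real.log (1 / δ)} := by
  refine one_sub_le_toOuterMeasure _ _ (tsum_run_mul_expWeight_le_one M O γ env hR hZ T) hδ.le _
    fun h hh hbad => ?_
  have hlt : 2 * O.sqLoss (observations M env h) + 2 * R * Real.log (1 / δ) <
      cumMeanSqError M O γ env h := by
    by_contra hle
    exact hbad ⟨length_of_run_ne_zero M O γ env hh, not_lt.1 hle⟩
  rw [expWeight, ← ENNReal.ofReal_mul hδ.le, ENNReal.one_le_ofReal]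
  have hexp : Real.log (1 / δ) ≤
      (cumMeanSqError M O γ env h / 2 - O.sqLoss (observations M env h)) / R := by
    rw [le_div_iff₀ hR]
    linarith
  have := Real.exp_le_exp.2 hexp
  rw [Real.exp_log (by positivity), div_le_iff₀ hδ] at this
  linarith

end Concentration

/-! ### Regret -/

section Regret

variable {K : ℕ} {n : ℕ} (M : Market.{u, v} n) (O : Oracle M.Input) (γ : ℝ≥0)
  (env : Environment M.Context K)

theorem length_observations (h : List (Fin K)) : (observations M env h).length = h.length := by
  induction h with
  | nil => rfl
  | cons i h ih => simp [observations, ih]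

theorem eq_production_of_mem_observations {h : List (Fin K)} {z : M.Input × ℝ}
    (hz : z ∈ observations M env h) : z.2 = M.production z.1 := by
  induction h with
  | nil => simp [observations] at hz
  | cons i h ih =>
    rcases List.mem_cons.1 hz with rfl | hz
    · rfl
    · exact ih hz

theorem Oracle.sqLoss_nonneg {A : Type*} (O : Oracle A) (data : List (A × ℝ)) :
    0 ≤ O.sqLoss data := by
  induction data with
  | nil => exact le_rfl
  | cons z data ih => exact add_nonneg ih (sq_nonneg _)

/-- The misspecified approximant is the competitor: its error on each exact output is at most `ε`.
-/
theorem sqLoss_observations_le {B : ℝ} (hB : ∀ a, M.production a ∈ Set.Icc 0 B)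
    {F : Set (M.Input → ℝ)} {ε : ℝ} (hF : IsMisspecified F M.production ε) {T : ℕ} {Est : ℝ}
    (hO : O.HasEstError F (Set.Icc 0 B) T Est) {h : List (Fin K)} (hh : h.length = T) :
    O.sqLoss (observations M env h) ≤ Est + ε ^ 2 * T := by
  obtain ⟨f, hf, hfε⟩ := hF
  have hreg := hO (observations M env h) ((length_observations M env h).trans hh) fun z hz => by
    rw [eq_production_of_mem_observations M env hz]
    exact hB _
  have hinf : (⨅ f : F, ((observations M env h).map fun z => (f.1 z.1 - z.2) ^ 2).sum) ≤
      ((observations M env h).map fun z => (f z.1 - z.2) ^ 2).sum := by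
    refine ciInf_le (f := fun f : F => ((observations M env h).map
      fun z => (f.1 z.1 - z.2) ^ 2).sum) ⟨0, ?_⟩ ⟨f, hf⟩
    rintro _ ⟨g, rfl⟩
    refine List.sum_nonneg fun x hx => ?_
    obtain ⟨z, -, rfl⟩ := List.mem_map.1 hx
    exact sq_nonneg _
  have hsum : ((observations M env h).map fun z => (f z.1 - z.2) ^ 2).sum ≤
      ((observations M env h).map fun z => (f z.1 - z.2) ^ 2).length • ε ^ 2 := by
    refine List.sum_le_card_nsmul _ _ fun x hx => ?_
    obtain ⟨z, hz, rfl⟩ := List.mem_map.1 hx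
    rw [eq_production_of_mem_observations M env hz]
    exact sq_le_sq' (abs_le.1 (hfε _)).1 (abs_le.1 (hfε _)).2
  rw [List.length_map, length_observations, hh, nsmul_eq_mul] at hsum
  linarith

variable [NeZero K]

theorem proxyRegret_le {L : ℝ} (hL : 0 ≤ L)
    (hlip : ∀ (p q : Icc (0 : ℝ) 1) (θ : M.Context),
      |M.production (p, θ) - M.production (q, θ)| ≤ L * |(p : ℝ) - q|)
    (hK : 2 ≤ K) (hγ : 0 < γ)
    (hd : ∀ h, ∃ p : Set.Icc (0 : ℝ) 1, M.production (p, env.context h) = env.demand h)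
    (h : List (Fin K)) :
    proxyRegret M O γ env h ≤
      h.length * (2 * L / K + 2 * K / γ) + γ * cumMeanSqError M O γ env h := by
  induction h with
  | nil => simp [proxyRegret, cumMeanSqError]
  | cons _ h ih =>
    obtain ⟨p, hp⟩ := hd h
    -- The comparator is a grid price near the equilibrium price.
    obtain ⟨j, hj⟩ := exists_gridPrice_near hK p
    have hstep := sum_igw_mul_le γ hγ
      (fun i => |O (observations M env h) (gridPrice i, env.context h) - env.demand h|)
      (fun i => |M.production (gridPrice i, env.context h) - env.demand h|) j
    have hw : |M.production (gridPrice j, env.context h) - env.demand h| ≤ 2 * L / K := by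
      rw [← hp]
      refine (hlip _ _ _).trans ((mul_le_mul_of_nonneg_left hj hL).trans_eq ?_)
      ring
    have hZ : ∑ i, (priceDist M O γ env h i).toReal *
        (|O (observations M env h) (gridPrice i, env.context h) - env.demand h| -
          |M.production (gridPrice i, env.context h) - env.demand h|) ^ 2 ≤
        meanSqError M O γ env h := by
      unfold meanSqError sqError
      refine Finset.sum_le_sum fun i _ => mul_le_mul_of_nonneg_left ?_ ENNReal.toReal_nonneg
      rw [sq_le_sq]
      refine (abs_abs_sub_abs_le_abs_sub _ _).trans_eq ?_
      rw [sub_sub_sub_cancel_right]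
    have hZ' := mul_le_mul_of_nonneg_left hZ γ.2
    simp only [proxyRegret, cumMeanSqError, List.length_cons, Nat.cast_add, Nat.cast_one]
    change ∑ i, (priceDist M O γ env h i).toReal * _ ≤ _ + γ * ∑ i,
      (priceDist M O γ env h i).toReal * _ + _ at hstep
    change (γ : ℝ) * _ ≤ γ * _ at hZ'
    linarith

/-- No sign is assumed: `Est` alone may be negative, and then its root is `0`. -/
theorem sqrt_add_le_add_sqrt (a b : ℝ) : √(a + b) ≤ √a + √b := by
  rcases le_total a 0 with ha | ha
  · exact (Real.sqrt_le_sqrt (by linarith)).trans (le_add_of_nonneg_left (Real.sqrt_nonneg _))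
  rcases le_total b 0 with hb | hb
  · exact (Real.sqrt_le_sqrt (by linarith)).trans (le_add_of_nonneg_right (Real.sqrt_nonneg _))
  rw [Real.sqrt_le_left (by positivity), add_sq, Real.sq_sqrt ha, Real.sq_sqrt hb]
  have : 0 ≤ 2 * √a * √b := by positivity
  linarith

end Regret

end EqPricing

theorem mainTheorem4 (n : ℕ) (μ : Fin n → ℝ) (hμ : ∀ i, 0 < μ i) (B : ℝ) :
    ∃ C : ℝ, 0 < C ∧
      ∀ M : EqPricing.Market.{u, v} n,
        (∀ i θ, EqPricing.IsSupplierCost (μ i) (M.cost i (M.φ i) θ)) →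
        (∀ a, M.production a ∈ Set.Icc 0 B) →
      ∀ (F : Set (M.Input → ℝ)) (ε : ℝ), EqPricing.IsMisspecified F M.production ε →
      ∀ (T : ℕ) (O : EqPricing.Oracle M.Input) (Est : ℝ),
        (∀ data a, O data a ∈ Set.Icc 0 B) →
        O.HasEstError F (Set.Icc 0 B) T Est →
      ∀ (K : ℕ) [NeZero K], 2 ≤ K →
      ∀ δ : ℝ, 0 < δ → δ < 1 →
      ∀ γ : ℝ≥0, (γ : ℝ) = √(K * T / (Est + ε ^ 2 * T + Real.log (1 / δ))) →
      ∀ env : EqPricing.Environment M.Context K,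
        -- every demand is cleared by an equilibrium price in `[0, 1]`
        (∀ h, ∃ p : Set.Icc (0 : ℝ) 1, M.production (p, env.context h) = env.demand h) →
        ENNReal.ofReal (1 - δ) ≤ (EqPricing.run M O γ env T).toOuterMeasure
          {h | EqPricing.proxyRegret M O γ env h ≤
            C * (√(K * T * Est) + ε * √K * T + T / K + √(K * T * Real.log (1 / δ)))} := by
  have hL : 0 ≤ ∑ i, 2 / μ i := Finset.sum_nonneg fun i _ => (div_pos two_pos (hμ i)).le
  set L := ∑ i, 2 / μ i with hLdef
  -- The three summands pay for the grid, the estimation error and `2 * K * T / γ`. Using `B ^ 2 +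
  -- 1` keeps the scale positive even when `B = 0`.
  refine ⟨2 * L + 2 * (B ^ 2 + 1) + 2, by positivity, ?_⟩
  intro M hM hB F ε hF T O Est hOB hO K _ hK δ hδ hδ1 γ hγ env hd
  have hε : 0 ≤ ε := by
    obtain ⟨f, -, hf⟩ := hF
    exact (abs_nonneg _).trans (hf (EqPricing.gridPrice (0 : Fin K), env.context []))
  have hlog : 0 < Real.log (1 / δ) := Real.log_pos ((one_lt_div hδ).2 hδ1)
  have hZ : ∀ h i, EqPricing.sqError M O env h i ≤ B ^ 2 + 1 := fun h i => by
    have h1 := hOB (EqPricing.observations M env h) (EqPricing.gridPrice i, env.context h)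
    have h2 := hB (EqPricing.gridPrice i, env.context h)
    have h3 := sq_le_sq' (by linarith [h1.1, h2.2]) (by linarith [h1.2, h2.1] :
      O (EqPricing.observations M env h) (EqPricing.gridPrice i, env.context h) -
        M.production (EqPricing.gridPrice i, env.context h) ≤ B)
    unfold EqPricing.sqError
    linarith
  refine (EqPricing.cumMeanSqError_le_with_high_probability M O γ env (R := B ^ 2 + 1)
    (by positivity) hZ T hδ).trans ?_
  refine MeasureTheory.measure_mono ?_
  rintro h ⟨hlen, hcum⟩
  rw [Set.mem_ofPred_eq]
  -- For `T = 0` the rate `γ` vanishes, but the regret is an empty sum.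
  rcases T.eq_zero_or_pos with rfl | hT
  · rw [List.length_eq_zero_iff.1 hlen]
    simp [EqPricing.proxyRegret]
  have hT' : (0 : ℝ) < T := by exact_mod_cast hT
  have hK' : (0 : ℝ) < K := by exact_mod_cast (by omega : 0 < K)
  have hloss := EqPricing.sqLoss_observations_le M O env hB hF hO hlen
  have hloss0 := O.sqLoss_nonneg (EqPricing.observations M env h)
  set D := Est + ε ^ 2 * T + Real.log (1 / δ) with hD
  have hDpos : 0 < D := by linarith
  have hγpos : (0 : ℝ) < γ := by
    rw [hγ]
    positivity
  have hreg := EqPricing.proxyRegret_le M O γ env hL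
    (EqPricing.Market.production_lipschitz hμ M hM) hK (by exact_mod_cast hγpos) hd h
  rw [hlen] at hreg
  set S := √(K * T * D) with hS
  have hγD : γ * D = S := by
    rw [hγ, hS, show (K : ℝ) * T * D = K * T / D * D ^ 2 by field_simp,
      Real.sqrt_mul (by positivity), Real.sqrt_sq hDpos.le]
  have hKTγ : T * (2 * K / γ) = 2 * S := by
    have hsq : (γ : ℝ) ^ 2 * D = K * T := by
      rw [hγ, Real.sq_sqrt (by positivity)]
      field_simp
    rw [← hγD]
    field_simp
    linarith
  -- As `B ^ 2 + 1 ≥ 1`, the factor of the logarithm also dominates that of the loss.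
  have hcum' : EqPricing.cumMeanSqError M O γ env h ≤ 2 * (B ^ 2 + 1) * D := by
    have := mul_nonneg (sq_nonneg B) (hloss0.trans hloss)
    rw [hD]
    nlinarith
  have hγcum := mul_le_mul_of_nonneg_left hcum' hγpos.le
  have hSle : S ≤ √(K * T * Est) + ε * √K * T + √(K * T * Real.log (1 / δ)) := by
    have e : √(K * T * (ε ^ 2 * T)) = ε * √K * T := by
      rw [show (K : ℝ) * T * (ε ^ 2 * T) = K * (ε * T) ^ 2 by ring, Real.sqrt_mul hK'.le,
        Real.sqrt_sq (by positivity)]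
      ring
    rw [hS, hD, mul_add, mul_add, ← e]
    exact (EqPricing.sqrt_add_le_add_sqrt _ _).trans
      (add_le_add_left (EqPricing.sqrt_add_le_add_sqrt _ _) _)
  have hTK : 0 ≤ (T : ℝ) / K := by positivity
  have hS0 : 0 ≤ S := Real.sqrt_nonneg _
  calc EqPricing.proxyRegret M O γ env h
      ≤ 2 * L * (T / K) + (2 * (B ^ 2 + 1) + 2) * S := by
        have e1 : (γ : ℝ) * (2 * (B ^ 2 + 1) * D) = 2 * (B ^ 2 + 1) * S := by
          rw [← hγD]
          ring
        have e2 : T * (2 * L / K) = 2 * L * ((T : ℝ) / K) := by ring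
        rw [mul_add] at hreg
        linarith
    _ ≤ (2 * L + 2 * (B ^ 2 + 1) + 2) * (S + T / K) := by
        have h1 := mul_nonneg hL hS0
        have h2 := mul_nonneg (by positivity : 0 ≤ 2 * (B ^ 2 + 1) + 2) hTK
        linarith
    _ ≤ _ := mul_le_mul_of_nonneg_left (by linarith) (by positivity)
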